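/- Let $\mathcal D=L^\infty([0,1])$ (with respect to Lebesgue measure) and let $\tau(f)=\int_0^1 f(x)\,dx$ for $f\in\mathcal D$. Let $(\mathcal M,\mathcal E)$ be a $\mathcal D$-valued W$^*$-noncommutative probability space, i.e. $\mathcal M$ is a unital W$^*$-algebra containing $\mathcal D$ as a unital W$^*$-subalgebra and $\mathcal E:\mathcal M\to\mathcal D$ is a normal $\mathcal D$-bimodule projection of norm one; assume that $\tau\circ\mathcal E$ is a normal, faithful, tracial state on $\mathcal M$. Let $\eta$ be a finite Borel measure on $[0,1]^2$ whose push-forwards under both coordinate projections are absolutely continuous with respect to Lebesgue measure on $[0,1]$ and have bounded Radon--Nikodym derivatives. Let $\alpha_\eta,\beta_\eta:\mathcal D\to\mathcal D$ be the linear maps determined by $$\int_0^1(\alpha_\eta f)(y)h(y)\,dy=\int_{[0,1]^2}f(x)h(y)\,d\eta(x,y),\qquad \int_0^1(\beta_\eta g)(x)h(x)\,dx=\int_{[0,1]^2}h(x)g(y)\,d\eta(x,y)$$ for all $f,g\in\mathcal D$ and $h\in L^1([0,1])$. Let $z_\eta\in\mathcal M$ be a $\mathcal D$-circular operator with covariance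 $(\alpha_\eta,\beta_\eta)$: all $\mathcal D$-valued free cumulants of the pair $(z_\eta,z_\eta^*)$ of order different from $2$ vanish, and for all $b\in\mathcal D$ $$\mathcal E(z_\eta^*bz_\eta)=\alpha_\eta(b),\quad \mathcal E(z_\eta bz_\eta^*)=\beta_\eta(b),\quad \mathcal E(z_\eta bz_\eta)=\mathcal E(z_\eta^*bz_\eta^*)=\mathcal E(z_\eta)=\mathcal E(z_\eta^*)=0.$$ Suppose that $\eta$ is supported on the set $\{(s,t)\mid 0\le s\le t\le 1\}$ and that, for some $\delta>0$, the restriction of $\eta$ to $\{(s,t)\mid 0\le s\le t\le 1,\ t-s\le\delta\}$ is absolutely continuous with respect to Lebesgue measure on $[0,1]^2$ and has bounded Radon--Nikodym derivative. Then $z_\eta$ is quasinilpotent, i.e. its spectrum is $\{0\}$. -/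

import Mathlib

open MeasureTheory
open scoped ENNReal NNReal ComplexOrder

/-! ### The C*-algebra `L^∞([0,1])` -/

/-- Lebesgue measure on `[0,1]`. -/
noncomputable abbrev leb : Measure unitInterval := volume

/-- `L^∞([0,1])`: essentially bounded complex functions on `[0,1]` modulo equality almost
everywhere with respect to Lebesgue measure, with the essential supremum norm. -/
abbrev Linf : Type := Lp ℂ ∞ leb

namespace Linf

noncomputable instance instMul : Mul Linf where
  mul f g := MemLp.toLp (fun x => f x * g x)
    (MemLp.mul (p := ∞) (q := ∞) (r := ∞) (Lp.memLp g) (Lp.memLp f))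

noncomputable instance instOne : One Linf where
  one := MemLp.toLp (fun _ => (1 : ℂ)) (memLp_const 1)

theorem coeFn_mul (f g : Linf) : ∀ᵐ x ∂leb, (f * g) x = f x * g x :=
  MemLp.coeFn_toLp (MemLp.mul (p := ∞) (q := ∞) (r := ∞) (Lp.memLp g) (Lp.memLp f))

theorem coeFn_one : ∀ᵐ x ∂leb, (1 : Linf) x = 1 :=
  MemLp.coeFn_toLp (memLp_const (1 : ℂ))

theorem coeFn_add' (f g : Linf) : ∀ᵐ x ∂leb, (f + g) x = f x + g x := Lp.coeFn_add f g

theorem coeFn_smul' (c : ℂ) (f : Linf) : ∀ᵐ x ∂leb, (c • f) x = c * f x := Lp.coeFn_smul c f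

theorem coeFn_star' (f : Linf) : ∀ᵐ x ∂leb, (star f) x = star (f x) := Lp.coeFn_star f

theorem ext' {f g : Linf} (h : ∀ᵐ x ∂leb, f x = g x) : f = g := Lp.ext h

theorem ae_norm_le (f : Linf) : ∀ᵐ x ∂leb, ‖f x‖ ≤ ‖f‖ := by
  have h := ae_le_eLpNormEssSup (f := (f : unitInterval → ℂ))
    (μ := leb)
  filter_upwards [h] with x hx
  have h2 : eLpNormEssSup f leb ≠ ∞ := by
    rw [← eLpNorm_exponent_top]
    exact Lp.eLpNorm_ne_top f
  have h3 := ENNReal.toReal_mono h2 hx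
  rw [Lp.norm_def, eLpNorm_exponent_top]
  simpa using h3

theorem norm_le_of_ae {f : Linf} {C : ℝ} (hC : 0 ≤ C) (h : ∀ᵐ x ∂leb, ‖f x‖ ≤ C) : ‖f‖ ≤ C := by
  rw [Lp.norm_def, eLpNorm_exponent_top]
  refine ENNReal.toReal_le_of_le_ofReal hC ?_
  exact eLpNormEssSup_le_of_ae_bound h

noncomputable instance instCommRing : CommRing Linf :=
  { (inferInstance : AddCommGroup Linf), instMul, instOne with
    left_distrib := fun f g h => ext' (by
      filter_upwards [coeFn_mul f (g + h), coeFn_add' g h, coeFn_add' (f * g) (f * h),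
        coeFn_mul f g, coeFn_mul f h] with x h1 h2 h3 h4 h5
      rw [h1, h2, h3, h4, h5, mul_add])
    right_distrib := fun f g h => ext' (by
      filter_upwards [coeFn_mul (f + g) h, coeFn_add' f g, coeFn_add' (f * h) (g * h),
        coeFn_mul f h, coeFn_mul g h] with x h1 h2 h3 h4 h5
      rw [h1, h2, h3, h4, h5, add_mul])
    zero_mul := fun f => ext' (by
      filter_upwards [coeFn_mul 0 f, Lp.coeFn_zero ℂ ∞ leb]
        with x h1 h2
      rw [h1, h2]; simp)
    mul_zero := fun f => ext' (by
      filter_upwards [coeFn_mul f 0, Lp.coeFn_zero ℂ ∞ leb]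
        with x h1 h2
      rw [h1, h2]; simp)
    mul_assoc := fun f g h => ext' (by
      filter_upwards [coeFn_mul (f * g) h, coeFn_mul f g, coeFn_mul f (g * h),
        coeFn_mul g h] with x h1 h2 h3 h4
      rw [h1, h2, h3, h4, mul_assoc])
    one_mul := fun f => ext' (by
      filter_upwards [coeFn_mul 1 f, coeFn_one] with x h1 h2
      rw [h1, h2, one_mul])
    mul_one := fun f => ext' (by
      filter_upwards [coeFn_mul f 1, coeFn_one] with x h1 h2
      rw [h1, h2, mul_one])
    mul_comm := fun f g => ext' (by
      filter_upwards [coeFn_mul f g, coeFn_mul g f] with x h1 h2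
      rw [h1, h2, mul_comm]) }

noncomputable instance instNormedCommRing : NormedCommRing Linf :=
  { instCommRing, (inferInstance : NormedAddCommGroup Linf) with
    norm_mul_le := fun f g => norm_le_of_ae (by positivity) (by
      filter_upwards [coeFn_mul f g, ae_norm_le f, ae_norm_le g] with x h1 h2 h3
      rw [h1, norm_mul]; gcongr) }

noncomputable instance instStarRing : StarRing Linf where
  star_mul f g := ext' (by
    filter_upwards [coeFn_star' (f * g), coeFn_mul f g, coeFn_mul (star g) (star f),
      coeFn_star' f, coeFn_star' g] with x h1 h2 h3 h4 h5
    rw [h1, h2, h3, h4, h5, star_mul])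
  star_add f g := ext' (by
    filter_upwards [coeFn_star' (f + g), coeFn_add' f g, coeFn_add' (star f) (star g),
      coeFn_star' f, coeFn_star' g] with x h1 h2 h3 h4 h5
    rw [h1, h2, h3, h4, h5, star_add])

noncomputable instance instAlgebra : Algebra ℂ Linf :=
  Algebra.ofModule
    (fun c f g => ext' (by
      filter_upwards [coeFn_mul (c • f) g, coeFn_smul' c f, coeFn_smul' c (f * g),
        coeFn_mul f g] with x h1 h2 h3 h4
      rw [h1, h2, h3, h4, mul_assoc]))
    (fun c f g => ext' (by
      filter_upwards [coeFn_mul f (c • g), coeFn_smul' c g, coeFn_smul' c (f * g),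
        coeFn_mul f g] with x h1 h2 h3 h4
      rw [h1, h2, h3, h4, mul_left_comm]))

noncomputable instance instNormedAlgebra : NormedAlgebra ℂ Linf :=
  { instAlgebra with norm_smul_le := fun c f => norm_smul_le c f }

noncomputable instance instStarModule : StarModule ℂ Linf where
  star_smul c f := ext' (by
    filter_upwards [coeFn_star' (c • f), coeFn_smul' c f, coeFn_smul' (star c) (star f),
      coeFn_star' f] with x h1 h2 h3 h4
    rw [h1, h2, h3, h4, star_mul, mul_comm])

noncomputable instance instCStarRing : CStarRing Linf where
  norm_mul_self_le f := by
    have key : ‖f‖ ≤ Real.sqrt ‖star f * f‖ := norm_le_of_ae (Real.sqrt_nonneg _) (by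
      filter_upwards [coeFn_mul (star f) f, coeFn_star' f, ae_norm_le (star f * f)]
        with x h1 h2 h3
      rw [h1, h2, norm_mul, norm_star] at h3
      exact Real.le_sqrt_of_sq_le (by rw [sq]; exact h3))
    calc ‖f‖ * ‖f‖ ≤ Real.sqrt ‖star f * f‖ * Real.sqrt ‖star f * f‖ := by gcongr
      _ = ‖star f * f‖ := Real.mul_self_sqrt (norm_nonneg _)

noncomputable instance instCommCStarAlgebra : CommCStarAlgebra Linf where

end Linf

/-! ### Measures on `[0,1]²` and the maps they induce on `L^∞([0,1])` -/

/-- `μ` is absolutely continuous with respect to `ν`, with bounded Radon--Nikodym derivative. -/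
def HasBoundedDensity {X : Type*} [MeasurableSpace X] (μ ν : Measure X) : Prop :=
  μ ≪ ν ∧ ∃ C : ℝ≥0, ∀ᵐ x ∂ν, μ.rnDeriv ν x ≤ C

/-- A finite Borel measure on `[0,1]²` both of whose coordinate push-forwards are absolutely
continuous with respect to Lebesgue measure with bounded Radon--Nikodym derivative. -/
structure IsCovarianceMeasure (η : Measure (unitInterval × unitInterval)) : Prop where
  finite : IsFiniteMeasure η
  fst : HasBoundedDensity (η.map Prod.fst) leb
  snd : HasBoundedDensity (η.map Prod.snd) leb

namespace IsCovarianceMeasure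

theorem swap {η : Measure (unitInterval × unitInterval)} (hη : IsCovarianceMeasure η) :
    IsCovarianceMeasure (η.map Prod.swap) := by
  have := hη.finite
  refine ⟨inferInstance, ?_, ?_⟩
  · rw [Measure.map_map measurable_fst measurable_swap]
    exact hη.snd
  · rw [Measure.map_map measurable_snd measurable_swap]
    exact hη.fst

theorem unique_aux {g₁ g₂ : Linf}
    (h : ∀ h : unitInterval → ℂ, Integrable h leb → ∫ y, g₁ y * h y ∂leb = ∫ y, g₂ y * h y ∂leb) :
    g₁ = g₂ := by
  have int : ∀ g : Linf, Integrable (g : unitInterval → ℂ) leb := fun g =>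
    (Lp.memLp g).integrable (by simp)
  refine Linf.ext' (Integrable.ae_eq_of_forall_setIntegral_eq _ _ (int g₁) (int g₂) ?_)
  intro s hs _
  have := h (s.indicator fun _ => 1) ((integrable_const 1).indicator hs)
  have e : ∀ g : Linf, (fun y => g y * s.indicator (fun _ => (1 : ℂ)) y)
      = s.indicator (fun y => g y) := by
    intro g; ext y; by_cases hy : y ∈ s <;> simp [hy]
  rw [e, e, integral_indicator hs, integral_indicator hs] at this
  exact this

theorem exists_left {η : Measure (unitInterval × unitInterval)} (hη : IsCovarianceMeasure η)
    (f : Linf) : ∃ g : Linf, ∀ h : unitInterval → ℂ, Integrable h leb →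
      ∫ y, g y * h y ∂leb = ∫ p, f p.1 * h p.2 ∂η := by
  have := hη.finite
  have : (η.map Prod.snd).HaveLebesgueDecomposition leb :=
    Measure.haveLebesgueDecomposition_of_sigmaFinite _ _
  obtain ⟨hac, C, hC⟩ := hη.snd
  have hfst := hη.fst.1
  -- a bounded measurable representative of `f`
  obtain ⟨f₁, hf₁m, hf₁⟩ : ∃ f₁ : unitInterval → ℂ, StronglyMeasurable f₁ ∧
      ∀ᵐ x ∂leb, f x = f₁ x := (Lp.aestronglyMeasurable f)
  set S : Set unitInterval := {x | ‖f₁ x‖ ≤ ‖f‖} with hS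
  have hSm : MeasurableSet S := measurableSet_le hf₁m.norm.measurable measurable_const
  set f₀ : unitInterval → ℂ := S.indicator f₁ with hf₀
  have hf₀m : StronglyMeasurable f₀ := hf₁m.indicator hSm
  have hf₀b : ∀ x, ‖f₀ x‖ ≤ ‖f‖ := by
    intro x
    by_cases hx : x ∈ S
    · simp only [hf₀, Set.indicator_of_mem hx]; exact hx
    · simp [hf₀, Set.indicator_of_notMem hx]
  have hf₀e : ∀ᵐ x ∂leb, f x = f₀ x := by
    filter_upwards [hf₁, Linf.ae_norm_le f] with x h1 h2
    have : x ∈ S := by rw [h1] at h2; exact h2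
    rw [hf₀, Set.indicator_of_mem this, h1]
  set η' : Measure (unitInterval × unitInterval) := η.map Prod.swap with hη'
  have hη'fst : η'.fst = η.map Prod.snd := by
    rw [Measure.fst, hη', Measure.map_map measurable_fst measurable_swap]; rfl
  set k : unitInterval → ℂ := fun y => ∫ x, f₀ x ∂(η'.condKernel y) with hk
  have hkm : StronglyMeasurable k := by
    exact StronglyMeasurable.integral_kernel hf₀m
  have hkb : ∀ y, ‖k y‖ ≤ ‖f‖ := by
    intro y
    refine (norm_integral_le_of_norm_le_const (Filter.Eventually.of_forall hf₀b)).trans ?_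
    simp
  set ν : Measure unitInterval := η.map Prod.snd with hν
  set ρ : unitInterval → ℝ := fun y => (ν.rnDeriv leb y).toReal with hρ
  have hρm : Measurable ρ := (Measure.measurable_rnDeriv _ _).ennreal_toReal
  have hmem : MemLp (fun y => (ρ y : ℂ) * k y) ∞ leb := by
    refine memLp_top_of_bound (C := C * ‖f‖) ?_ ?_
    · exact ((Complex.measurable_ofReal.comp hρm).aestronglyMeasurable).mul
        hkm.aestronglyMeasurable
    · filter_upwards [hC] with y hy
      have : ρ y ≤ C := ENNReal.toReal_le_of_le_ofReal C.2 (by simpa using hy)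
      rw [norm_mul, Complex.norm_real, Real.norm_of_nonneg ENNReal.toReal_nonneg]
      gcongr
      exact hkb y
  refine ⟨hmem.toLp _, fun h hh => ?_⟩
  have h_int : Integrable h ν := by
    have hle : ν ≤ (C : ℝ≥0∞) • leb := by
      rw [← Measure.withDensity_rnDeriv_eq ν leb hac, ← withDensity_const]
      exact withDensity_mono hC
    exact (hh.smul_measure (by simp : (C : ℝ≥0∞) ≠ ∞)).mono_measure hle
  have hdis : η'.fst.compProd η'.condKernel = η' := η'.disintegrate η'.condKernel
  have hη'int : Integrable (fun q : unitInterval × unitInterval => f₀ q.2 * h q.1) η' := by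
    have h1 : Integrable (fun q : unitInterval × unitInterval => h q.1) η' := by
      have : Integrable h (η'.map Prod.fst) := by
        have e : η'.map Prod.fst = ν := hη'fst
        rw [e]; exact h_int
      exact this.comp_measurable measurable_fst
    exact h1.bdd_mul (hf₀m.comp_measurable measurable_snd).aestronglyMeasurable
      (Filter.Eventually.of_forall fun q => hf₀b q.2)
  calc ∫ y, hmem.toLp _ y * h y ∂leb = ∫ y, ρ y • (k y * h y) ∂leb := by
        refine integral_congr_ae ?_
        filter_upwards [hmem.coeFn_toLp] with y hy
        rw [hy, Complex.real_smul, mul_assoc]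
    _ = ∫ y, k y * h y ∂ν := integral_rnDeriv_smul hac
    _ = ∫ q, f₀ q.2 * h q.1 ∂η' := by
        rw [← hdis] at hη'int
        conv_rhs => rw [← hdis]
        rw [Measure.integral_compProd hη'int, hη'fst]
        refine integral_congr_ae (Filter.Eventually.of_forall fun y => ?_)
        simp only [hk]
        rw [integral_mul_const]
    _ = ∫ p, f₀ p.1 * h p.2 ∂η := by
        exact MeasurableEquiv.prodComm.measurableEmbedding.integral_map _
    _ = ∫ p, f p.1 * h p.2 ∂η := by
        refine integral_congr_ae ?_
        have h2 : ∀ᵐ x ∂(η.map Prod.fst), f x = f₀ x := hfst.ae_le hf₀e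
        filter_upwards [ae_of_ae_map measurable_fst.aemeasurable h2] with p hp
        rw [hp]

theorem exists_right {η : Measure (unitInterval × unitInterval)} (hη : IsCovarianceMeasure η)
    (g : Linf) : ∃ f : Linf, ∀ h : unitInterval → ℂ, Integrable h leb →
      ∫ x, f x * h x ∂leb = ∫ p, h p.1 * g p.2 ∂η := by
  obtain ⟨f, hf⟩ := hη.swap.exists_left g
  refine ⟨f, fun h hh => ?_⟩
  refine (hf h hh).trans
    ((MeasurableEquiv.prodComm.measurableEmbedding.integral_map _).trans ?_)
  exact integral_congr_ae (Filter.Eventually.of_forall fun p => mul_comm _ _)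

theorem integrable_snd {η : Measure (unitInterval × unitInterval)} (hη : IsCovarianceMeasure η)
    {h : unitInterval → ℂ} (hh : Integrable h leb) (f : Linf) :
    Integrable (fun p : unitInterval × unitInterval => f p.1 * h p.2) η := by
  have := hη.finite
  have : (η.map Prod.snd).HaveLebesgueDecomposition leb :=
    Measure.haveLebesgueDecomposition_of_sigmaFinite _ _
  obtain ⟨hac, C, hC⟩ := hη.snd
  have hle : η.map Prod.snd ≤ (C : ℝ≥0∞) • leb := by
    rw [← Measure.withDensity_rnDeriv_eq (η.map Prod.snd) leb hac, ← withDensity_const]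
    exact withDensity_mono hC
  have h1 : Integrable h (η.map Prod.snd) :=
    (hh.smul_measure (by simp : (C : ℝ≥0∞) ≠ ∞)).mono_measure hle
  refine (h1.comp_measurable measurable_snd).bdd_mul (c := ‖f‖) ?_ ?_
  · exact ((Lp.aestronglyMeasurable f).mono_ac hη.fst.1).comp_measurable measurable_fst
  · exact ae_of_ae_map measurable_fst.aemeasurable (hη.fst.1.ae_le (Linf.ae_norm_le f))

end IsCovarianceMeasure

/-- The map `α_η : L^∞([0,1]) → L^∞([0,1])`, determined by
`∫ (α_η f)(y) h(y) dy = ∫ f(x) h(y) dη(x,y)` for all `h ∈ L¹([0,1])`. -/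
noncomputable def alphaMap (η : Measure (unitInterval × unitInterval))
    (hη : IsCovarianceMeasure η) : Linf →ₗ[ℂ] Linf where
  toFun f := (hη.exists_left f).choose
  map_add' f₁ f₂ := IsCovarianceMeasure.unique_aux fun h hh => by
    have key : ∀ᵐ p ∂η, (f₁ + f₂) p.1 * h p.2 = f₁ p.1 * h p.2 + f₂ p.1 * h p.2 := by
      filter_upwards [ae_of_ae_map measurable_fst.aemeasurable
        (hη.fst.1.ae_le (Linf.coeFn_add' f₁ f₂))] with p hp
      rw [hp, add_mul]
    have e : ∀ g₁ g₂ : Linf, ∫ y, (g₁ + g₂) y * h y ∂leb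
        = ∫ y, g₁ y * h y ∂leb + ∫ y, g₂ y * h y ∂leb := fun g₁ g₂ => by
      rw [← integral_add (hh.bdd_mul (Lp.aestronglyMeasurable g₁) (Linf.ae_norm_le g₁))
        (hh.bdd_mul (Lp.aestronglyMeasurable g₂) (Linf.ae_norm_le g₂))]
      refine integral_congr_ae ?_
      filter_upwards [Linf.coeFn_add' g₁ g₂] with y hy
      rw [hy, add_mul]
    rw [e, (hη.exists_left (f₁ + f₂)).choose_spec h hh, (hη.exists_left f₁).choose_spec h hh,
      (hη.exists_left f₂).choose_spec h hh, integral_congr_ae key,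
      integral_add (hη.integrable_snd hh f₁) (hη.integrable_snd hh f₂)]
  map_smul' c f := IsCovarianceMeasure.unique_aux fun h hh => by
    have key : ∀ᵐ p ∂η, (c • f) p.1 * h p.2 = c * (f p.1 * h p.2) := by
      filter_upwards [ae_of_ae_map measurable_fst.aemeasurable
        (hη.fst.1.ae_le (Linf.coeFn_smul' c f))] with p hp
      rw [hp, mul_assoc]
    have e : ∀ g : Linf, ∫ y, (c • g) y * h y ∂leb = c * ∫ y, g y * h y ∂leb := fun g => by
      rw [← integral_const_mul]
      refine integral_congr_ae ?_
      filter_upwards [Linf.coeFn_smul' c g] with y hy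
      rw [hy, mul_assoc]
    rw [RingHom.id_apply, e, (hη.exists_left (c • f)).choose_spec h hh,
      (hη.exists_left f).choose_spec h hh, integral_congr_ae key, integral_const_mul]

theorem alphaMap_spec {η : Measure (unitInterval × unitInterval)}
    (hη : IsCovarianceMeasure η) (f : Linf) (h : unitInterval → ℂ) (hh : Integrable h leb) :
    ∫ y, alphaMap η hη f y * h y ∂leb = ∫ p, f p.1 * h p.2 ∂η :=
  (hη.exists_left f).choose_spec h hh

/-- The map `β_η : L^∞([0,1]) → L^∞([0,1])`, determined by
`∫ (β_η g)(x) h(x) dx = ∫ h(x) g(y) dη(x,y)` for all `h ∈ L¹([0,1])`: it is `α` for the image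
of `η` under `(x,y) ↦ (y,x)`. -/
noncomputable def betaMap (η : Measure (unitInterval × unitInterval))
    (hη : IsCovarianceMeasure η) : Linf →ₗ[ℂ] Linf :=
  alphaMap (η.map Prod.swap) hη.swap

theorem betaMap_spec {η : Measure (unitInterval × unitInterval)}
    (hη : IsCovarianceMeasure η) (g : Linf) (h : unitInterval → ℂ) (hh : Integrable h leb) :
    ∫ x, betaMap η hη g x * h x ∂leb = ∫ p, h p.1 * g p.2 ∂η :=
  (alphaMap_spec hη.swap g h hh).trans
    ((MeasurableEquiv.prodComm.measurableEmbedding.integral_map _).trans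
      (integral_congr_ae (Filter.Eventually.of_forall fun _ => mul_comm _ _)))

/-! ### Operator-valued free cumulants and `B`-circular elements -/

/-- All ways to write a word as `g₀ x₁ g₁ x₂ g₂ ⋯ x_k g_k` with `k ≥ 0`, letters `x_i` and
(possibly empty) words `g_i`; such a decomposition is recorded as
`(g₀, [(x₁, g₁), …, (x_k, g_k)])`. -/
def splittings {A : Type*} : List A → List (List A × List (A × List A))
  | [] => [([], [])]
  | a :: l => (splittings l).flatMap fun s => [(a :: s.1, s.2), ([], (a, s.1) :: s.2)]

/-- The `B`-valued free cumulants `κ_n(a₁, …, a_n)` of elements of `A`, with respect to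
`ι : B → A` and `E : A → B`, determined recursively by the moment-cumulant formula
`E(a₁ ⋯ a_n) = ∑_π κ_π(a₁, …, a_n)`, the sum over the noncrossing partitions `π` of `{1, …, n}`.

Grouping the partitions by the block `V = {1 = i₁ < i₂ < ⋯ < i_k}` of `1`, and summing over the
partitions of the gaps between consecutive elements of `V`, each of which contributes the
corresponding moment, this formula reads
`E(a₁ ⋯ a_n) = ∑_V κ_k(x₁ E(g₁), x₂ E(g₂), …, x_k E(g_k))`
where `a₁ ⋯ a_n = x₁ g₁ x₂ g₂ ⋯ x_k g_k` is the factorization with `x_j = a_{i_j}`.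
The term of `V = {1, …, n}` is `κ_n(a₁, …, a_n)`. The empty word gets the value `0`. -/
noncomputable def freeCumulant {A B : Type*} [Ring A] [Ring B] (ι : B → A) (E : A → B) :
    List A → B
  | [] => 0
  | a :: l => E (a :: l).prod -
      (((splittings l).filter fun s => s.2.length < l.length).attach.map fun s =>
        freeCumulant ι E (((a, s.1.1) :: s.1.2).map fun p => p.1 * ι (E p.2.prod))).sum
  termination_by w => w.length
  decreasing_by
    have := (List.mem_filter.1 s.2).2
    simpa using this

/-- `z` is a `B`-circular element with covariance `(α, β)`: the pair `(z, z*)` has a `B`-Gaussian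
distribution, i.e. all its `B`-valued free cumulants except those of order two vanish, with the
covariance determined by `α` and `β`. -/
structure IsCircular {A B : Type*} [Ring A] [StarRing A] [Algebra ℂ A] [Ring B] [StarRing B]
    [Algebra ℂ B] (ι : B → A) (E : A → B) (α β : B →ₗ[ℂ] B) (z : A) : Prop where
  cov_star_self : ∀ b, E (star z * ι b * z) = α b
  cov_self_star : ∀ b, E (z * ι b * star z) = β b
  cov_self_self : ∀ b, E (z * ι b * z) = 0
  cov_star_star : ∀ b, E (star z * ι b * star z) = 0
  mean_self : E z = 0
  mean_star : E (star z) = 0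
  gaussian : ∀ w : List (Bool × B), w ≠ [] → w.length ≠ 2 →
    freeCumulant ι E (w.map fun p => (if p.1 then star z else z) * ι p.2) = 0

/-! ### `L^∞([0,1])`-valued W*-noncommutative probability spaces -/

/-- The order of a C*-algebra: `a ≤ b` when `b - a = c* c` for some `c`. -/
def StarLE {A : Type*} [Ring A] [StarRing A] (a b : A) : Prop :=
  ∃ c, b - a = star c * c

/-- `x` is the least upper bound of `S` for the order of the C*-algebra. -/
def IsStarLUB {A : Type*} [Ring A] [StarRing A] (S : Set A) (x : A) : Prop :=
  (∀ a ∈ S, StarLE a x) ∧ ∀ y, (∀ a ∈ S, StarLE a y) → StarLE x y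

/-- Normality of a (positive) map: it preserves the suprema of bounded increasing nets of
self-adjoint elements. -/
def IsNormalMap {A B : Type*} [Ring A] [StarRing A] [Ring B] [StarRing B] (φ : A → B) : Prop :=
  ∀ (S : Set A) (x : A), S.Nonempty → (∀ a ∈ S, IsSelfAdjoint a) → DirectedOn StarLE S →
    IsStarLUB S x → IsStarLUB (φ '' S) (φ x)

/-- `(M, E)` is an `L^∞([0,1])`-valued W*-noncommutative probability space, for the unital
inclusion `ι` of `L^∞([0,1])` as a W*-subalgebra and the normal projection `E` of norm one. -/
structure IsWStarProbSpace {M : Type*} [CStarAlgebra M] [WStarAlgebra M]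
    (ι : Linf →⋆ₐ[ℂ] M) (E : M →L[ℂ] Linf) : Prop where
  injective : Function.Injective ι
  normal_incl : IsNormalMap ι
  proj : ∀ b, E (ι b) = b
  bimodule : ∀ b a c, E (ι b * a * ι c) = b * E a * c
  norm_eq_one : ‖E‖ = 1
  normal : IsNormalMap E

/-- The trace `f ↦ ∫ f(x) dx` on `L^∞([0,1])`. -/
noncomputable def Linf.trace (f : Linf) : ℂ := ∫ x, f x ∂leb

/-- `τ ∘ E` is a normal, faithful, tracial state on `M`, where `τ` is integration with respect
to Lebesgue measure. (It is automatically linear with `τ(E(1)) = 1`.) -/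
structure IsFaithfulTracial {M : Type*} [CStarAlgebra M] (E : M →L[ℂ] Linf) : Prop where
  nonneg : ∀ x, 0 ≤ (E (star x * x)).trace
  faithful : ∀ x, (E (star x * x)).trace = 0 → x = 0
  tracial : ∀ x y, (E (x * y)).trace = (E (y * x)).trace
  normal : IsNormalMap fun x => (E x).trace

/-- An element of a unital Banach algebra is quasinilpotent if its spectrum is `{0}`. -/
def IsQuasinilpotent {A : Type*} [Ring A] [Algebra ℂ A] (a : A) : Prop :=
  spectrum ℂ a = {0}

/-- All factorizations `l = g ++ x :: h` of a word, recorded as `(g, x, h)`. -/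
def letterSplits {A : Type*} : List A → List (List A × A × List A)
  | [] => []
  | a :: l => ([], a, l) :: (letterSplits l).map fun s => (a :: s.1, s.2)

theorem eq_of_mem_letterSplits {A : Type*} {l : List A} {s : List A × A × List A}
    (hs : s ∈ letterSplits l) : l = s.1 ++ s.2.1 :: s.2.2 := by
  induction l generalizing s with
  | nil => simp [letterSplits] at hs
  | cons a l ih =>
    simp only [letterSplits, List.mem_cons, List.mem_map] at hs
    rcases hs with rfl | ⟨t, ht, rfl⟩
    · rfl
    · simp [ih ht]

/-- The two gaps around a chosen letter of `a :: l` have lengths adding up to `l.length`, and each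
such pair occurs once. This turns a sum over partners into a Catalan convolution. -/
theorem sum_letterSplits_length {A R : Type*} [AddCommMonoid R] (F : ℕ → ℕ → R) (a : A)
    (l : List A) :
    ((letterSplits (a :: l)).map fun s => F s.1.length s.2.2.length).sum =
      ∑ p ∈ Finset.HasAntidiagonal.antidiagonal l.length, F p.1 p.2 := by
  induction l generalizing a F with
  | nil => simp [letterSplits]
  | cons b l ih =>
    rw [letterSplits, List.map_cons, List.sum_cons, List.map_map, List.length_cons,
      Finset.Nat.sum_antidiagonal_succ, ← ih (fun i j => F (i + 1) j) b]
    rfl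

theorem sum_map_flatMap {A C R : Type*} [AddCommMonoid R] (F : C → R) (f : A → List C)
    (l : List A) :
    ((l.flatMap f).map F).sum = (l.map fun a => ((f a).map F).sum).sum := by
  induction l with
  | nil => simp
  | cons a l ih => simp [ih]

theorem sum_splittings_nil {A R : Type*} [AddCommMonoid R] (F : List A × List (A × List A) → R)
    (l : List A) :
    ((splittings l).map fun s => if s.2.length = 0 then F s else 0).sum = F (l, []) := by
  induction l generalizing F with
  | nil => simp [splittings]
  | cons a l ih =>
    rw [splittings, sum_map_flatMap, ← ih (fun s => F (a :: s.1, s.2))]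
    simp

/-- In the moment-cumulant formula these are the splittings in which the block of the first letter
is a pair; choosing one amounts to choosing the partner. -/
theorem sum_splittings_single {A R : Type*} [AddCommMonoid R]
    (F : List A × List (A × List A) → R) (l : List A) :
    ((splittings l).map fun s => if s.2.length = 1 then F s else 0).sum =
      ((letterSplits l).map fun s => F (s.1, [s.2])).sum := by
  induction l generalizing F with
  | nil => simp [splittings, letterSplits]
  | cons a l ih =>
    rw [splittings, sum_map_flatMap, letterSplits, List.map_cons,
      List.sum_cons, List.map_map]
    have h1 := ih (fun s => F (a :: s.1, s.2))
    have h0 := sum_splittings_nil (fun s => F ([], (a, s.1) :: s.2)) l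
    simp only [Function.comp_def]
    rw [← h1, ← h0, ← List.sum_map_add]
    congr 1
    refine List.map_congr_left fun s _ => ?_
    simp [add_comm]

theorem fst_mem_of_mem_splittings {A : Type*} {l : List A} {s : List A × List (A × List A)}
    (hs : s ∈ splittings l) : ∀ p ∈ s.2, p.1 ∈ l := by
  induction l generalizing s with
  | nil => simp [splittings] at hs; simp [hs]
  | cons a l ih =>
    simp only [splittings, List.mem_flatMap] at hs
    obtain ⟨t, ht, hs⟩ := hs
    have := ih ht
    simp only [List.mem_cons, List.not_mem_nil, or_false] at hs
    rcases hs with rfl | rfl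
    · intro p hp; exact List.mem_cons_of_mem _ (this p hp)
    · intro p hp
      rcases List.mem_cons.1 hp with rfl | hp
      · simp
      · exact List.mem_cons_of_mem _ (this p hp)

/-- The letters `z b` and `z* b`, with `b` in the algebra of scalars. -/
def IsCircularLetter {A B : Type*} [Mul A] [Star A] (ι : B → A) (z a : A) : Prop :=
  ∃ (e : Bool) (b : B), a = (if e then star z else z) * ι b

/-! ### Moments of a circular element -/

section Moments

variable {A : Type*} [CStarAlgebra A] {ι : Linf →⋆ₐ[ℂ] A} {E : A →L[ℂ] Linf}
  {α β : Linf →ₗ[ℂ] Linf} {z : A}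

theorem IsCircularLetter.mul_right {a : A} (h : IsCircularLetter ι z a) (c : Linf) :
    IsCircularLetter ι z (a * ι c) := by
  obtain ⟨e, b, rfl⟩ := h
  exact ⟨e, b * c, by rw [map_mul, mul_assoc]⟩

theorem IsCircular.freeCumulant_eq_zero (hz : IsCircular ι E α β z) {l : List A}
    (hl : ∀ a ∈ l, IsCircularLetter ι z a) (h0 : l ≠ []) (h2 : l.length ≠ 2) :
    freeCumulant ι E l = 0 := by
  have : ∃ w : List (Bool × Linf),
      w.map (fun p => (if p.1 then star z else z) * ι p.2) = l := by
    clear h0 h2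
    induction l with
    | nil => exact ⟨[], rfl⟩
    | cons a l ih =>
      obtain ⟨w, hw⟩ := ih fun b hb => hl b (List.mem_cons_of_mem _ hb)
      obtain ⟨e, b, h⟩ := hl a List.mem_cons_self
      exact ⟨(e, b) :: w, by rw [List.map_cons, hw, ← h]⟩
  obtain ⟨w, rfl⟩ := this
  exact hz.gaussian w (by simpa using h0) (by simpa using h2)

/-- Unfolds the recursion with an `if` in place of the filtered, attached list, so that the sum can
be reindexed. -/
theorem freeCumulant_cons (a : A) (l : List A) :
    E (a :: l).prod = freeCumulant ι E (a :: l) +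
      ((splittings l).map fun s => if s.2.length < l.length then
        freeCumulant ι E (((a, s.1) :: s.2).map fun p => p.1 * ι (E p.2.prod)) else 0).sum := by
  rw [freeCumulant, List.attach_map_val (f := fun s : List A × List (A × List A) =>
    freeCumulant ι E (((a, s.1) :: s.2).map fun p => p.1 * ι (E p.2.prod)))]
  rw [List.sum_map_ite]
  simp

/-- The only correction to the second moment is the first-order cumulant of `a * ι (E x)`, which is
again a circular letter and so has vanishing cumulant; `x` itself may be arbitrary. -/
theorem IsCircular.freeCumulant_pair (hz : IsCircular ι E α β z) {a x : A}
    (ha : IsCircularLetter ι z a) : freeCumulant ι E [a, x] = E (a * x) := by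
  have h := freeCumulant_cons (ι := ι) (E := E) a [x]
  have h1 : freeCumulant ι E [a * ι (E x)] = 0 :=
    hz.freeCumulant_eq_zero (by simpa using ha.mul_right _) (by simp) (by simp)
  simp [splittings, h1] at h
  exact h.symm

variable [WStarAlgebra A]

theorem IsWStarProbSpace.map_one (hE : IsWStarProbSpace ι E) : E 1 = 1 := by
  simpa using hE.proj 1

theorem IsWStarProbSpace.map_mul_right (hE : IsWStarProbSpace ι E) (a : A) (b : Linf) :
    E (a * ι b) = E a * b := by
  simpa using hE.bimodule 1 a b

theorem IsWStarProbSpace.map_mul_left (hE : IsWStarProbSpace ι E) (a : A) (b : Linf) :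
    E (ι b * a) = b * E a := by
  simpa using hE.bimodule b a 1

theorem IsCircular.map_letter (hz : IsCircular ι E α β z) (hE : IsWStarProbSpace ι E) {a : A}
    (ha : IsCircularLetter ι z a) : E a = 0 := by
  obtain ⟨e, b, rfl⟩ := ha
  rw [hE.map_mul_right]
  cases e <;> simp [hz.mean_self, hz.mean_star]

/-- The moments of a circular element obey the recursion over the partner of the first letter. -/
theorem IsCircular.map_prod_cons (hz : IsCircular ι E α β z) (hE : IsWStarProbSpace ι E) {a : A} {l : List A}
    (ha : IsCircularLetter ι z a) (hl : ∀ x ∈ l, IsCircularLetter ι z x) :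
    E (a :: l).prod = ((letterSplits l).map fun s =>
      E (a * ι (E s.1.prod) * s.2.1) * E s.2.2.prod).sum := by
  -- Multiplying by scalars keeps the arguments circular letters, so every term whose block does not
  -- have size two vanishes.
  have key : ∀ s ∈ splittings l, (if s.2.length < l.length then
      freeCumulant ι E (((a, s.1) :: s.2).map fun p => p.1 * ι (E p.2.prod)) else 0) =
      if s.2.length = 1 then (if 1 < l.length then
        freeCumulant ι E (((a, s.1) :: s.2).map fun p => p.1 * ι (E p.2.prod)) else 0) else 0 := by
    intro s hs
    by_cases h1 : s.2.length = 1
    · simp only [h1, if_true]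
    · rw [if_neg h1, hz.freeCumulant_eq_zero, ite_self]
      · intro x hx
        obtain ⟨p, hp, rfl⟩ := List.mem_map.1 hx
        rcases List.mem_cons.1 hp with rfl | hp
        · exact ha.mul_right _
        · exact (hl _ (fst_mem_of_mem_splittings hs p hp)).mul_right _
      · simp
      · simpa using h1
  rw [freeCumulant_cons (ι := ι), List.map_congr_left key, sum_splittings_single]
  have e : ∀ s : List A × A × List A,
      freeCumulant ι E (((a, s.1) :: [s.2]).map fun p => p.1 * ι (E p.2.prod)) =
        E (a * ι (E s.1.prod) * s.2.1) * E s.2.2.prod := by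
    intro s
    simp only [List.map_cons, List.map_nil]
    rw [hz.freeCumulant_pair (ha.mul_right _), ← mul_assoc, hE.map_mul_right]
  simp only [e]
  -- For a two-letter word the pair block is the full block, so its term is the leading cumulant and
  -- is absent from the sum. For all other lengths the leading cumulant vanishes.
  match l, hl with
  | [], hl =>
    simp only [letterSplits, List.map_nil, List.sum_nil, add_zero]
    exact hz.freeCumulant_eq_zero (by simpa using ha) (by simp) (by simp)
  | [x], hl =>
    simp [letterSplits, hz.freeCumulant_pair ha, hE.map_one, map_one ι, mul_one]
  | x :: y :: l, hl =>
    rw [hz.freeCumulant_eq_zero (by simpa using ⟨ha, by simpa using hl⟩) (by simp) (by simp)]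
    simp

/-- Moments of circular letters are bounded by Catalan numbers. -/
theorem IsCircular.norm_map_prod_le (hz : IsCircular ι E α β z) (hE : IsWStarProbSpace ι E) {Q : Set A} {r : ℝ} (hr : 0 ≤ r)
    (hQ : ∀ a ∈ Q, IsCircularLetter ι z a)
    (hcov : ∀ a ∈ Q, ∀ x ∈ Q, ∀ b, ‖E (a * ι b * x)‖ ≤ r ^ 2 * ‖b‖) (l : List A)
    (hl : ∀ a ∈ l, a ∈ Q) : ‖E l.prod‖ ≤ r ^ l.length * catalan l.length := by
  induction hn : l.length using Nat.strong_induction_on generalizing l with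
  | _ n ih =>
  subst hn
  match l, hl with
  | [], _ =>
    simp only [List.prod_nil, hE.map_one, List.length_nil, pow_zero, catalan_zero, Nat.cast_one,
      mul_one]
    exact Linf.norm_le_of_ae zero_le_one (by
      filter_upwards [Linf.coeFn_one] with x hx
      simp [hx])
  | [a], hl =>
    have : E [a].prod = 0 := by simpa using hz.map_letter hE (hQ a (hl a (by simp)))
    rw [this, norm_zero]
    positivity
  | a :: b :: l, hl =>
    have hl' : ∀ x ∈ b :: l, x ∈ Q := fun x hx => hl x (List.mem_cons_of_mem _ hx)
    rw [hz.map_prod_cons hE (hQ a (hl a (by simp))) fun x hx => hQ x (hl' x hx)]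
    have step : ∀ s ∈ letterSplits (b :: l),
        ‖E (a * ι (E s.1.prod) * s.2.1) * E s.2.2.prod‖ ≤
          r ^ (l.length + 2) * (catalan s.1.length * catalan s.2.2.length : ℝ) := by
      intro s hs
      have hs' := eq_of_mem_letterSplits hs
      have hlen : l.length = s.1.length + s.2.2.length := by
        have := congrArg List.length hs'
        simp at this
        omega
      rw [hs'] at hl'
      have h1 := ih s.1.length (by simp; omega) s.1 (fun x hx => hl' x (by simp [hx])) rfl
      have h2 := ih s.2.2.length (by simp; omega) s.2.2 (fun x hx => hl' x (by simp [hx])) rfl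
      calc _ ≤ ‖E (a * ι (E s.1.prod) * s.2.1)‖ * ‖E s.2.2.prod‖ := norm_mul_le _ _
        _ ≤ (r ^ 2 * (r ^ s.1.length * catalan s.1.length)) *
            (r ^ s.2.2.length * catalan s.2.2.length) := by
          gcongr
          exact (hcov a (hl a (by simp)) s.2.1 (hl' _ (by simp)) _).trans (by gcongr)
        _ = _ := by rw [hlen]; ring
    calc _ ≤ ((letterSplits (b :: l)).map fun s =>
            ‖E (a * ι (E s.1.prod) * s.2.1) * E s.2.2.prod‖).sum := by
          refine (List.le_sum_of_subadditive norm norm_zero.le norm_add_le _).trans ?_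
          rw [List.map_map]
          rfl
      _ ≤ ((letterSplits (b :: l)).map fun s =>
            r ^ (l.length + 2) * (catalan s.1.length * catalan s.2.2.length : ℝ)).sum :=
          List.sum_le_sum step
      _ = r ^ (l.length + 2) * catalan (l.length + 1) := by
          rw [sum_letterSplits_length
            (fun i j => r ^ (l.length + 2) * (catalan i * catalan j : ℝ)), catalan_succ',
            ← Finset.mul_sum]
          push_cast
          rfl
      -- The pair removes two letters while the convolution index rises by one, so the recursion
      -- yields the Catalan number one below the word length. It is dominated by the next one, as
      -- the term `(0, l.length + 1)` of its convolution.
      _ ≤ r ^ (l.length + 2) * catalan (l.length + 2) := by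
          gcongr
          rw [catalan_succ' (l.length + 1)]
          refine le_trans ?_ (Finset.single_le_sum (f := fun p : ℕ × ℕ => catalan p.1 * catalan p.2)
            (fun _ _ => Nat.zero_le _) (a := (0, l.length + 1)) (by simp))
          simp

end Moments

/-! ### From moment growth to the norm -/

theorem catalan_le_four_pow (n : ℕ) : catalan n ≤ 4 ^ n := by
  rw [catalan_eq_centralBinom_div]
  refine (Nat.div_le_self _ _).trans ?_
  have := Nat.sum_range_choose (2 * n)
  rw [pow_mul] at this
  norm_num at this
  rw [← this, Nat.centralBinom_eq_two_mul_choose]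
  exact Finset.single_le_sum (f := fun i => (2 * n).choose i) (fun _ _ => Nat.zero_le _)
    (Finset.mem_range.2 (by omega))

theorem Linf.integrable (f : Linf) : Integrable f leb :=
  (Lp.memLp f).integrable (by simp)

theorem Linf.trace_add (f g : Linf) : (f + g).trace = f.trace + g.trace := by
  rw [Linf.trace, Linf.trace, Linf.trace, ← integral_add f.integrable g.integrable]
  exact integral_congr_ae (Linf.coeFn_add' f g)

theorem Linf.trace_smul (c : ℂ) (f : Linf) : (c • f).trace = c * f.trace := by
  rw [Linf.trace, Linf.trace, ← integral_const_mul]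
  exact integral_congr_ae (Linf.coeFn_smul' c f)

theorem Linf.norm_trace_le (f : Linf) : ‖f.trace‖ ≤ ‖f‖ := by
  refine (norm_integral_le_of_norm_le_const (Linf.ae_norm_le f)).trans ?_
  simp

theorem IsFaithfulTracial.pos {M : Type*} [CStarAlgebra M] {E : M →L[ℂ] Linf}
    (hE : IsFaithfulTracial E) {y : M} (hy : y ≠ 0) : 0 < (E (star y * y)).trace :=
  lt_of_le_of_ne (hE.nonneg y) fun h => hy (hE.faithful y h.symm)

/-- The norm of an element is controlled by its moments with respect to a faithful trace. -/
theorem IsFaithfulTracial.norm_le_of_moments_le {M : Type*} [CStarAlgebra M]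
    {E : M →L[ℂ] Linf} (hE : IsFaithfulTracial E) {x : M} {R : ℝ} (hR : 0 ≤ R)
    (h : ∀ n : ℕ, ‖(E ((star x * x) ^ n)).trace‖ ≤ R ^ n) : ‖star x * x‖ ≤ R := by
  by_contra! hlt
  obtain ⟨c, hRc, hc⟩ := exists_between hlt
  have hc0 : 0 < c := hR.trans_lt hRc
  set a := star x * x with ha_def
  have hN : 0 < ‖a‖ := hc0.trans hc
  have : Nontrivial M := ⟨a, 0, norm_pos_iff.1 hN⟩
  have ha : IsSelfAdjoint a := IsSelfAdjoint.star_mul_self x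
  have hspec : ∀ t ∈ spectrum ℝ a, 0 ≤ t ∧ t ≤ ‖a‖ := fun t ht =>
    ⟨spectrum_star_mul_self_nonneg t ht, (le_abs_self t).trans (spectrum.norm_le_norm_of_mem ht)⟩
  have hmem : ‖a‖ ∈ spectrum ℝ a := by
    rcases CStarAlgebra.norm_or_neg_norm_mem_spectrum ha with h | h
    · exact h
    · linarith [(hspec _ h).1]
  -- A cutoff supported above `c`: `f(a)` is nonzero because `‖a‖` lies in the spectrum, and on its
  -- support `t ^ n` is at least `c ^ n`.
  set f : ℝ → ℝ := fun t => max (t - c) 0 with hf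
  have hfc : Continuous f := by fun_prop
  set b := cfc f a with hb
  have hbs : IsSelfAdjoint b := cfc_predicate f a
  have hb0 : b ≠ 0 := by
    intro h0
    have h1 : f ‖a‖ ∈ spectrum ℝ b := by
      rw [hb, cfc_map_spectrum f a]
      exact ⟨_, hmem, rfl⟩
    rw [h0, spectrum.zero_eq, Set.mem_singleton_iff] at h1
    have : f ‖a‖ = ‖a‖ - c := max_eq_left (by linarith)
    linarith
  have hpos := hE.pos hb0
  set D : ℝ := (E (star b * b)).trace.re with hD
  have hDeq : (E (star b * b)).trace = D := by
    apply Complex.ext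
    · simp [hD]
    · simpa using (Complex.lt_def.1 hpos).2.symm
  have hDpos : 0 < D := (Complex.lt_def.1 hpos).1
  have key : ∀ n : ℕ, c ^ n * D ≤ ‖a‖ ^ 2 * R ^ n := by
    intro n
    -- Positivity of the trace is available only on elements `star y * y`, so the inequality `c ^ n
    -- f² ≤ ‖a‖² t ^ n` on the spectrum is transferred through the square root of the difference.
    set g : ℝ → ℝ := fun t => Real.sqrt (‖a‖ ^ 2 * t ^ n - c ^ n * (f t * f t)) with hg
    have hgc : Continuous g := by fun_prop
    have hgs : IsSelfAdjoint (cfc g a) := cfc_predicate g a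
    have hsq : star (cfc g a) * cfc g a
        = ((‖a‖ ^ 2 : ℝ) : ℂ) • a ^ n - ((c ^ n : ℝ) : ℂ) • (star b * b) := by
      rw [hgs.star_eq, hbs.star_eq, hb, ← cfc_mul g g a, ← cfc_mul f f a]
      have h1 : a ^ n = cfc (fun t : ℝ => t ^ n) a := (cfc_pow_id a n).symm
      rw [h1, Complex.coe_smul, Complex.coe_smul, ← cfc_smul (‖a‖ ^ 2) (fun t : ℝ => t ^ n) a,
        ← cfc_smul (c ^ n) (fun t => f t * f t) a,
        ← cfc_sub _ _ a]
      refine cfc_congr fun t ht => ?_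
      obtain ⟨h0, hle⟩ := hspec t ht
      simp only [hg, smul_eq_mul]
      refine Real.mul_self_sqrt (sub_nonneg.2 ?_)
      rcases le_total t c with htc | htc
      · have : f t = 0 := max_eq_right (by linarith)
        rw [this]; simp; positivity
      · have hft : f t = t - c := max_eq_left (by linarith)
        have h1 : f t ≤ ‖a‖ := by rw [hft]; linarith
        have h2 : 0 ≤ f t := le_max_right _ _
        calc c ^ n * (f t * f t) ≤ t ^ n * (‖a‖ * ‖a‖) := by gcongr
          _ = _ := by ring
    have h0 := hE.nonneg (cfc g a)
    rw [hsq, sub_eq_add_neg, ← neg_smul, map_add, Linf.trace_add, map_smul, map_smul,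
      Linf.trace_smul, Linf.trace_smul, hDeq] at h0
    have h1 := (Complex.le_def.1 h0).1
    simp only [Complex.zero_re, Complex.add_re, Complex.re_ofReal_mul, ← Complex.ofReal_neg,
      Complex.ofReal_re] at h1
    have h2 := (Complex.re_le_norm _).trans (h n)
    have h3 : 0 ≤ ‖a‖ ^ 2 := by positivity
    nlinarith [mul_le_mul_of_nonneg_left h2 h3]
  -- Since `R < c`, letting `n → ∞` would force the trace of `f(a)²` to be at most zero, against
  -- faithfulness.
  have hratio : Filter.Tendsto (fun n : ℕ => ‖a‖ ^ 2 * (R / c) ^ n) Filter.atTop (nhds 0) := by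
    simpa using (tendsto_pow_atTop_nhds_zero_of_lt_one (by positivity)
      ((div_lt_one hc0).2 hRc)).const_mul (‖a‖ ^ 2)
  refine absurd (ge_of_tendsto' hratio fun n => ?_) hDpos.not_ge
  rw [div_pow, ← mul_div_assoc, le_div_iff₀ (by positivity), mul_comm]
  exact key n

/-! ### Weighted integral estimates -/

theorem HasBoundedDensity.exists_le_smul {X : Type*} [MeasurableSpace X] {μ ν : Measure X}
    [IsFiniteMeasure μ] [IsFiniteMeasure ν] (h : HasBoundedDensity μ ν) :
    ∃ C : ℝ≥0, μ ≤ (C : ℝ≥0∞) • ν := by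
  obtain ⟨hac, C, hC⟩ := h
  refine ⟨C, ?_⟩
  rw [← Measure.withDensity_rnDeriv_eq μ ν hac, ← withDensity_const]
  exact withDensity_mono hC

/-- Weighted estimate for a measure on a square that is dominated by the product measure on a
set `S`, when the weight decays off `S`. -/
theorem lintegral_weight_mul_le {η : Measure (unitInterval × unitInterval)}
    {W : unitInterval → ℝ≥0∞} (hW : Measurable W) {S : Set (unitInterval × unitInterval)}
    (hS : MeasurableSet S) {C K a b : ℝ≥0∞}
    (hC : η.restrict S ≤ C • (leb.prod leb)) (hK : η.map Prod.snd ≤ K • leb)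
    (ha : ∀ y, ∫⁻ x in {x | (x, y) ∈ S}, W x ∂leb ≤ a * W y)
    (hb : ∀ᵐ p ∂η, p ∉ S → W p.1 ≤ b * W p.2)
    {H : unitInterval → ℝ≥0∞} (hH : Measurable H) :
    ∫⁻ p, W p.1 * H p.2 ∂η ≤ (C * a + K * b) * ∫⁻ y, W y * H y ∂leb := by
  have hF : Measurable fun p : unitInterval × unitInterval => W p.1 * H p.2 :=
    (hW.comp measurable_fst).mul (hH.comp measurable_snd)
  have hWH : Measurable fun y => W y * H y := hW.mul hH
  -- On `S`, compare with the product measure and integrate the weight over each section.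
  have near : ∫⁻ p in S, W p.1 * H p.2 ∂η ≤ C * a * ∫⁻ y, W y * H y ∂leb := by
    calc ∫⁻ p in S, W p.1 * H p.2 ∂η
        = ∫⁻ p, S.indicator (fun p => W p.1 * H p.2) p ∂(η.restrict S) := by
          rw [lintegral_indicator hS, Measure.restrict_restrict hS, Set.inter_self]
      _ ≤ ∫⁻ p, S.indicator (fun p => W p.1 * H p.2) p ∂(C • (leb.prod leb)) :=
          lintegral_mono' hC le_rfl
      _ = C * ∫⁻ y, ∫⁻ x, S.indicator (fun p => W p.1 * H p.2) (x, y) ∂leb ∂leb := by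
          rw [lintegral_smul_measure, lintegral_prod_symm' _ (hF.indicator hS), smul_eq_mul]
      _ ≤ C * ∫⁻ y, a * (W y * H y) ∂leb := by
          gcongr with y
          have hSy : MeasurableSet {x | (x, y) ∈ S} := measurable_prodMk_right hS
          calc ∫⁻ x, S.indicator (fun p => W p.1 * H p.2) (x, y) ∂leb
              = ∫⁻ x in {x | (x, y) ∈ S}, W x * H y ∂leb := by
                rw [← lintegral_indicator hSy]
                rfl
            _ = (∫⁻ x in {x | (x, y) ∈ S}, W x ∂leb) * H y := lintegral_mul_const _ hW
            _ ≤ a * W y * H y := by gcongr; exact ha y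
            _ = _ := mul_assoc _ _ _
      _ = _ := by rw [lintegral_const_mul _ hWH, mul_assoc]
  -- Off `S`, trade `W p.1` for `b * W p.2`; the integrand then depends only on the second
  -- coordinate, and the marginal bound applies.
  have far : ∫⁻ p in Sᶜ, W p.1 * H p.2 ∂η ≤ K * b * ∫⁻ y, W y * H y ∂leb := by
    calc ∫⁻ p in Sᶜ, W p.1 * H p.2 ∂η ≤ ∫⁻ p in Sᶜ, b * (W p.2 * H p.2) ∂η := by
          refine lintegral_mono_ae ?_
          filter_upwards [ae_restrict_of_ae hb, ae_restrict_mem hS.compl] with p h1 h2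
          rw [← mul_assoc]
          gcongr
          exact h1 h2
      _ ≤ ∫⁻ p, b * (W p.2 * H p.2) ∂η := lintegral_mono' Measure.restrict_le_self le_rfl
      _ = ∫⁻ y, b * (W y * H y) ∂(η.map Prod.snd) :=
          (lintegral_map (hWH.const_mul b) measurable_snd).symm
      _ ≤ ∫⁻ y, b * (W y * H y) ∂(K • leb) := lintegral_mono' hK le_rfl
      _ = _ := by
          rw [lintegral_smul_measure, lintegral_const_mul _ hWH, smul_eq_mul, mul_assoc]
  rw [← lintegral_add_compl _ hS, add_mul]
  exact add_le_add near far

/-- Enlarging to a subset of `ℝ` permits the explicit exponential integrals over half-lines. -/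
theorem lintegral_unitInterval_le (f : ℝ → ℝ≥0∞) (T : Set unitInterval) (T' : Set ℝ)
    (hT : MeasurableSet T) (hT' : MeasurableSet T') (h : ∀ x ∈ T, (x : ℝ) ∈ T') :
    ∫⁻ x in T, f x ∂leb ≤ ∫⁻ x in T', f x := by
  rw [← lintegral_indicator hT, ← lintegral_indicator hT']
  calc ∫⁻ x, T.indicator (fun x => f x) x ∂leb ≤ ∫⁻ x : unitInterval, T'.indicator f x ∂leb := by
        refine lintegral_mono fun x => ?_
        by_cases hx : x ∈ T
        · simp [hx, h x hx]
        · simp [hx]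
    _ = ∫⁻ x in Set.Icc 0 1, T'.indicator f x :=
        lintegral_subtype_comap (s := Set.Icc (0 : ℝ) 1) measurableSet_Icc _
    _ ≤ ∫⁻ x, T'.indicator f x := lintegral_mono' Measure.restrict_le_self le_rfl

theorem lintegral_exp_mul_Iic {r : ℝ} (hr : 0 < r) (c : ℝ) :
    ∫⁻ x in Set.Iic c, ENNReal.ofReal (Real.exp (r * x)) =
      ENNReal.ofReal (1 / r) * ENNReal.ofReal (Real.exp (r * c)) := by
  rw [← ofReal_integral_eq_lintegral_ofReal (integrableOn_exp_mul_Iic hr c)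
    (Filter.Eventually.of_forall fun x => (Real.exp_pos _).le), integral_exp_mul_Iic hr,
    ← ENNReal.ofReal_mul (by positivity)]
  congr 1
  ring

theorem lintegral_exp_mul_Ici {r : ℝ} (hr : 0 < r) (c : ℝ) :
    ∫⁻ x in Set.Ici c, ENNReal.ofReal (Real.exp (-r * x)) =
      ENNReal.ofReal (1 / r) * ENNReal.ofReal (Real.exp (-r * c)) := by
  rw [setLIntegral_congr Ioi_ae_eq_Ici.symm,
    ← ofReal_integral_eq_lintegral_ofReal (integrableOn_exp_mul_Ioi (neg_lt_zero.2 hr) c)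
    (Filter.Eventually.of_forall fun x => (Real.exp_pos _).le),
    integral_exp_mul_Ioi (neg_lt_zero.2 hr),
    ← ENNReal.ofReal_mul (by positivity)]
  congr 1
  field_simp

/-! ### Weighted covariance maps on `L^∞` -/

/-- An essentially bounded function is bounded by `c` if it is so when tested against `L¹`. -/
theorem Linf.norm_le_of_forall_integral {g : Linf} {c : ℝ} (hc : 0 ≤ c)
    (h : ∀ f : unitInterval → ℂ, Integrable f leb →
      ‖∫ y, g y * f y ∂leb‖ ≤ c * ∫ y, ‖f y‖ ∂leb) : ‖g‖ ≤ c := by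
  refine Linf.norm_le_of_ae hc ?_
  refine ae_le_of_forall_setIntegral_le (f := fun x => ‖g x‖) (g := fun _ => c)
    g.integrable.norm (integrable_const c) fun s hs _ => ?_
  set f : unitInterval → ℂ := s.indicator fun y => star (g y) / ‖g y‖ with hf
  have hfb : ∀ y, ‖f y‖ ≤ s.indicator (fun _ => (1 : ℝ)) y := by
    intro y
    by_cases hy : y ∈ s
    · simp only [hf, Set.indicator_of_mem hy, norm_div, norm_star, Complex.norm_real, norm_norm]
      exact div_self_le_one _
    · simp [hf, hy]
  have hgm : AEStronglyMeasurable (g : unitInterval → ℂ) leb := Lp.aestronglyMeasurable g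
  have hint1 : Integrable (s.indicator (fun _ => (1 : ℝ))) leb := (integrable_const 1).indicator hs
  have hfi : Integrable f leb := by
    refine hint1.mono' ?_ (Filter.Eventually.of_forall hfb)
    refine AEStronglyMeasurable.indicator ?_ hs
    exact (continuous_star.comp_aestronglyMeasurable hgm).div₀
      (Complex.continuous_ofReal.comp_aestronglyMeasurable hgm.norm)
  have hgf : ∀ y, g y * f y = ((s.indicator (fun y => ‖g y‖) y : ℝ) : ℂ) := by
    intro y
    by_cases hy : y ∈ s
    · simp only [hf, Set.indicator_of_mem hy]
      rcases eq_or_ne (g y) 0 with h0 | h0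
      · simp [h0]
      · have : (‖g y‖ : ℂ) ≠ 0 := by simpa using h0
        rw [← mul_div_assoc, div_eq_iff this]
        simpa [sq] using Complex.mul_conj' (g y)
    · simp [hf, hy]
  have h1 := h f hfi
  simp only [hgf] at h1
  rw [integral_complex_ofReal, integral_indicator hs, Complex.norm_real, Real.norm_of_nonneg
    (integral_nonneg fun _ => norm_nonneg _)] at h1
  refine h1.trans ?_
  calc c * ∫ y, ‖f y‖ ∂leb ≤ c * ∫ y, s.indicator (fun _ => (1 : ℝ)) y ∂leb := by
        exact mul_le_mul_of_nonneg_left (integral_mono hfi.norm hint1 hfb) hc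
    _ = ∫ _ in s, c ∂leb := by
        rw [integral_indicator hs, ← integral_const_mul, mul_one]

/-- A weighted bound for `η` gives a norm bound for the weighted map `b ↦ α_η(w b) w⁻¹`. -/
theorem norm_alphaMap_mul_le {η : Measure (unitInterval × unitInterval)}
    (hη : IsCovarianceMeasure η) {W : unitInterval → ℝ≥0∞} {ε : ℝ≥0}
    (hW : ∀ H : unitInterval → ℝ≥0∞, Measurable H →
      ∫⁻ p, W p.1 * H p.2 ∂η ≤ ε * ∫⁻ y, W y * H y ∂leb)
    {w v : Linf} (hw : ∀ᵐ x ∂leb, ‖w x‖ₑ = W x) (hv : v * w = 1) (b : Linf) :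
    ‖alphaMap η hη (w * b) * v‖ ≤ ε * ‖b‖ := by
  refine Linf.norm_le_of_forall_integral (by positivity) fun f hf => ?_
  -- The factor `v` is absorbed into the test function; below, `|w| = W` and `v * w = 1` make the
  -- weight cancel it, leaving `|f|`.
  have hvf : Integrable (fun y => v y * f y) leb :=
    hf.bdd_mul (Lp.aestronglyMeasurable v) (Linf.ae_norm_le v)
  have e1 : ∫ y, (alphaMap η hη (w * b) * v) y * f y ∂leb
      = ∫ p, (w * b) p.1 * (v p.2 * f p.2) ∂η := by
    rw [← alphaMap_spec hη (w * b) _ hvf]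
    refine integral_congr_ae ?_
    filter_upwards [Linf.coeFn_mul (alphaMap η hη (w * b)) v] with y hy
    rw [hy, mul_assoc]
  obtain ⟨H, hHm, hH⟩ : AEMeasurable (fun y => ‖v y * f y‖ₑ) leb := hvf.1.enorm
  have hfst : ∀ {P : unitInterval → Prop}, (∀ᵐ x ∂leb, P x) → ∀ᵐ p ∂η, P p.1 := fun h =>
    ae_of_ae_map measurable_fst.aemeasurable (hη.fst.1.ae_le h)
  have hsnd : ∀ {P : unitInterval → Prop}, (∀ᵐ x ∂leb, P x) → ∀ᵐ p ∂η, P p.2 := fun h =>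
    ae_of_ae_map measurable_snd.aemeasurable (hη.snd.1.ae_le h)
  have e2 : ∫⁻ p, ‖(w * b) p.1 * (v p.2 * f p.2)‖ₑ ∂η ≤
      ENNReal.ofReal ‖b‖ * (ε * ENNReal.ofReal (∫ y, ‖f y‖ ∂leb)) := by
    calc ∫⁻ p, ‖(w * b) p.1 * (v p.2 * f p.2)‖ₑ ∂η
        ≤ ∫⁻ p, ENNReal.ofReal ‖b‖ * (W p.1 * H p.2) ∂η := by
          refine lintegral_mono_ae ?_
          filter_upwards [hfst hw, hfst (Linf.coeFn_mul w b), hfst (Linf.ae_norm_le b), hsnd hH]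
            with p h1 h2 h3 h4
          rw [enorm_mul, h4, h2, enorm_mul, h1, mul_comm (W p.1), mul_assoc]
          gcongr
          rw [← ofReal_norm]
          exact ENNReal.ofReal_le_ofReal h3
      _ = ENNReal.ofReal ‖b‖ * ∫⁻ p, W p.1 * H p.2 ∂η := lintegral_const_mul' _ _ (by simp)
      _ ≤ ENNReal.ofReal ‖b‖ * (ε * ∫⁻ y, W y * H y ∂leb) := by
          gcongr
          exact hW H hHm
      _ = _ := by
          rw [ofReal_integral_norm_eq_lintegral_enorm hf]
          congr 2
          refine lintegral_congr_ae ?_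
          filter_upwards [hw, hH, Linf.coeFn_mul v w, Linf.coeFn_one] with y h1 h2 h3 h4
          rw [hv, h4] at h3
          rw [← h1, ← h2, ← enorm_mul, ← mul_assoc, mul_comm (w y), ← h3, one_mul]
  rw [e1]
  have e3 := (norm_integral_le_lintegral_norm
    (fun p : unitInterval × unitInterval => (w * b) p.1 * (v p.2 * f p.2)) (μ := η))
  simp only [ofReal_norm] at e3
  refine (e3.trans (ENNReal.toReal_mono (by finiteness) e2)).trans_eq ?_
  rw [ENNReal.toReal_mul, ENNReal.toReal_mul, ENNReal.toReal_ofReal (norm_nonneg _),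
    ENNReal.toReal_ofReal (integral_nonneg fun _ => norm_nonneg _), ENNReal.coe_toReal]
  ring

/-! ### Exponential weights and triangular support -/

theorem memLp_exp (r : ℝ) :
    MemLp (fun x : unitInterval => ((Real.exp (r * x) : ℝ) : ℂ)) ∞ leb := by
  refine memLp_top_of_bound (C := Real.exp |r|) ?_ (Filter.Eventually.of_forall fun x => ?_)
  · exact Continuous.aestronglyMeasurable (by fun_prop)
  · rw [Complex.norm_real, Real.norm_of_nonneg (Real.exp_pos _).le]
    refine Real.exp_le_exp.2 ((le_abs_self _).trans ?_)
    rw [abs_mul, abs_of_nonneg x.2.1]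
    exact mul_le_of_le_one_right (abs_nonneg _) x.2.2

/-- The function `x ↦ e^{rx}` in `L^∞([0,1])`. -/
noncomputable def expWeight (r : ℝ) : Linf := (memLp_exp r).toLp _

theorem coeFn_expWeight (r : ℝ) : ∀ᵐ x ∂leb, expWeight r x = (Real.exp (r * x) : ℝ) :=
  (memLp_exp r).coeFn_toLp

theorem expWeight_mul (r s : ℝ) : expWeight r * expWeight s = expWeight (r + s) :=
  Linf.ext' (by
    filter_upwards [Linf.coeFn_mul (expWeight r) (expWeight s), coeFn_expWeight r,
      coeFn_expWeight s, coeFn_expWeight (r + s)] with x h1 h2 h3 h4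
    rw [h1, h2, h3, h4, ← Complex.ofReal_mul, ← Real.exp_add, add_mul])

theorem expWeight_zero : expWeight 0 = 1 :=
  Linf.ext' (by
    filter_upwards [coeFn_expWeight 0, Linf.coeFn_one] with x h1 h2
    rw [h1, h2]
    simp)

theorem star_expWeight (r : ℝ) : star (expWeight r) = expWeight r :=
  Linf.ext' (by
    filter_upwards [coeFn_expWeight r, Linf.coeFn_star' (expWeight r)] with x h1 h2
    rw [h2, h1]
    exact Complex.conj_ofReal _)

theorem enorm_expWeight (r : ℝ) :
    ∀ᵐ x ∂leb, ‖expWeight r x‖ₑ = ENNReal.ofReal (Real.exp (r * x)) := by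
  filter_upwards [coeFn_expWeight r] with x hx
  rw [hx, ← ofReal_norm, Complex.norm_real, Real.norm_of_nonneg (Real.exp_pos _).le]

section Triangular

variable {η : Measure (unitInterval × unitInterval)} {δ : ℝ} {C K : ℝ≥0∞}

theorem measurableSet_band (δ : ℝ) : MeasurableSet
    {p : unitInterval × unitInterval | p.1 ≤ p.2 ∧ (p.2 : ℝ) - (p.1 : ℝ) ≤ δ} :=
  (measurableSet_le measurable_fst measurable_snd).inter
    (measurableSet_le ((measurable_subtype_coe.comp measurable_snd).sub
      (measurable_subtype_coe.comp measurable_fst)) measurable_const)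

theorem measurable_exp_weight (r : ℝ) :
    Measurable fun x : unitInterval => ENNReal.ofReal (Real.exp (r * x)) := by
  fun_prop

/-- In the band, `x ≤ y` and the integral of `e^{rx}` over `(-∞, y]` is `e^{ry}/r`. Outside it, `x <
y - δ` almost everywhere, so `e^{rx} ≤ e^{-rδ} e^{ry}`. -/
theorem lintegral_exp_weight_le (hsupp : η {p | ¬ p.1 ≤ p.2} = 0)
    (hC : η.restrict {p | p.1 ≤ p.2 ∧ (p.2 : ℝ) - (p.1 : ℝ) ≤ δ} ≤ C • (leb.prod leb))
    (hK : η.map Prod.snd ≤ K • leb) {r : ℝ} (hr : 0 < r)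
    {H : unitInterval → ℝ≥0∞} (hH : Measurable H) :
    ∫⁻ p, ENNReal.ofReal (Real.exp (r * p.1)) * H p.2 ∂η ≤
      (C * ENNReal.ofReal (1 / r) + K * ENNReal.ofReal (Real.exp (-(r * δ)))) *
        ∫⁻ y, ENNReal.ofReal (Real.exp (r * y)) * H y ∂leb := by
  refine lintegral_weight_mul_le (measurable_exp_weight r) (measurableSet_band δ) hC hK
    (fun y => ?_) ?_ hH
  · rw [← lintegral_exp_mul_Iic hr]
    exact lintegral_unitInterval_le (fun x => ENNReal.ofReal (Real.exp (r * x))) _ _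
      (measurable_prodMk_right (measurableSet_band δ)) measurableSet_Iic fun x hx => hx.1
  · have h : ∀ᵐ p ∂η, p.1 ≤ p.2 := hsupp
    filter_upwards [h] with p hp hpS
    have hd : δ < (p.2 : ℝ) - (p.1 : ℝ) := by
      by_contra! hle
      exact hpS ⟨hp, hle⟩
    rw [← ENNReal.ofReal_mul (Real.exp_pos _).le, ← Real.exp_add]
    refine ENNReal.ofReal_le_ofReal (Real.exp_le_exp.2 ?_)
    nlinarith

/-- The mirror image needed for `betaMap`: the swap reverses the triangle, so the weight must
decrease for the same two effects to occur. -/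
theorem lintegral_exp_neg_weight_le (hsupp : η {p | ¬ p.1 ≤ p.2} = 0)
    (hC : η.restrict {p | p.1 ≤ p.2 ∧ (p.2 : ℝ) - (p.1 : ℝ) ≤ δ} ≤ C • (leb.prod leb))
    (hK : η.map Prod.fst ≤ K • leb) {r : ℝ} (hr : 0 < r)
    {H : unitInterval → ℝ≥0∞} (hH : Measurable H) :
    ∫⁻ p, ENNReal.ofReal (Real.exp (-r * p.1)) * H p.2 ∂(η.map Prod.swap) ≤
      (C * ENNReal.ofReal (1 / r) + K * ENNReal.ofReal (Real.exp (-(r * δ)))) *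
        ∫⁻ y, ENNReal.ofReal (Real.exp (-r * y)) * H y ∂leb := by
  have hS := measurable_swap (measurableSet_band δ)
  refine lintegral_weight_mul_le (measurable_exp_weight (-r)) hS ?_ ?_
    (fun y => ?_) ?_ hH
  · rw [Measure.restrict_map measurable_swap hS]
    refine (Measure.map_mono hC measurable_swap).trans_eq ?_
    rw [Measure.map_smul, Measure.prod_swap]
  · rw [Measure.map_map measurable_snd measurable_swap]
    exact hK
  · rw [← lintegral_exp_mul_Ici hr]
    exact lintegral_unitInterval_le (fun x => ENNReal.ofReal (Real.exp (-r * x))) _ _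
      (measurable_prodMk_right hS) measurableSet_Ici fun x hx => hx.1
  · have h : ∀ᵐ p ∂η, p.1 ≤ p.2 := hsupp
    refine MeasurableEquiv.prodComm.measurableEmbedding.ae_map_iff.2 ?_
    filter_upwards [h] with p hp hpS
    have hd : δ < (p.2 : ℝ) - (p.1 : ℝ) := by
      by_contra! hle
      exact hpS ⟨hp, hle⟩
    change ENNReal.ofReal (Real.exp (-r * p.2)) ≤
      ENNReal.ofReal (Real.exp (-(r * δ))) * ENNReal.ofReal (Real.exp (-r * p.1))
    rw [← ENNReal.ofReal_mul (Real.exp_pos _).le, ← Real.exp_add]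
    refine ENNReal.ofReal_le_ofReal (Real.exp_le_exp.2 ?_)
    nlinarith

/-- For suitable large `r`, conjugation by `e^{rx}` makes both covariance maps small. -/
theorem exists_weight_norm_le (hη : IsCovarianceMeasure η) (hsupp : η {p | ¬ p.1 ≤ p.2} = 0)
    (hδ : 0 < δ)
    (hdiag : HasBoundedDensity
      (η.restrict {p | p.1 ≤ p.2 ∧ (p.2 : ℝ) - (p.1 : ℝ) ≤ δ}) (leb.prod leb))
    {ε : ℝ≥0} (hε : 0 < ε) :
    ∃ r : ℝ, ∀ b : Linf,
      ‖alphaMap η hη (expWeight r * b) * expWeight (-r)‖ ≤ ε * ‖b‖ ∧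
      ‖betaMap η hη (expWeight (-r) * b) * expWeight r‖ ≤ ε * ‖b‖ := by
  have := hη.finite
  obtain ⟨C, hC⟩ := hdiag.exists_le_smul
  obtain ⟨K₁, hK₁⟩ := hη.fst.exists_le_smul
  obtain ⟨K₂, hK₂⟩ := hη.snd.exists_le_smul
  set K := max K₁ K₂
  have hle : ∀ K' : ℝ≥0, K' ≤ K → ((K' : ℝ≥0∞) • leb) ≤ (K : ℝ≥0∞) • leb := fun K' h => by
    gcongr
  have lim : Filter.Tendsto (fun r : ℝ => (C : ℝ) * (1 / r) + K * Real.exp (-(r * δ)))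
      Filter.atTop (nhds 0) := by
    have h1 : Filter.Tendsto (fun r : ℝ => 1 / r) Filter.atTop (nhds 0) := by
      simpa using tendsto_inv_atTop_zero (𝕜 := ℝ)
    have h2 : Filter.Tendsto (fun r : ℝ => Real.exp (-(r * δ))) Filter.atTop (nhds 0) :=
      Real.tendsto_exp_neg_atTop_nhds_zero.comp (Filter.tendsto_id.atTop_mul_const hδ)
    simpa using (h1.const_mul (C : ℝ)).add (h2.const_mul (K : ℝ))
  -- A single `r` must serve both maps, which is why the two marginal bounds were merged into `K`.
  obtain ⟨r, hrε, hr⟩ := ((lim.eventually_lt_const (show (0 : ℝ) < ε from hε)).and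
    (Filter.eventually_gt_atTop 0)).exists
  have hbound : (C : ℝ≥0∞) * ENNReal.ofReal (1 / r) +
      K * ENNReal.ofReal (Real.exp (-(r * δ))) ≤ ε := by
    rw [← ENNReal.ofReal_coe_nnreal (p := C), ← ENNReal.ofReal_coe_nnreal (p := K),
      ← ENNReal.ofReal_coe_nnreal (p := ε), ← ENNReal.ofReal_mul C.coe_nonneg,
      ← ENNReal.ofReal_mul K.coe_nonneg,
      ← ENNReal.ofReal_add (by positivity) (by positivity)]
    exact ENNReal.ofReal_le_ofReal hrε.le
  refine ⟨r, fun b => ⟨norm_alphaMap_mul_le hη (fun H hH => ?_) (enorm_expWeight r) ?_ b,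
    norm_alphaMap_mul_le hη.swap (fun H hH => ?_) (enorm_expWeight (-r)) ?_ b⟩⟩
  · refine (lintegral_exp_weight_le hsupp hC (hK₂.trans (hle _ (le_max_right _ _))) hr hH).trans ?_
    gcongr
  · rw [expWeight_mul, neg_add_cancel, expWeight_zero]
  · refine (lintegral_exp_neg_weight_le hsupp hC
      (hK₁.trans (hle _ (le_max_left _ _))) hr hH).trans ?_
    gcongr
  · rw [expWeight_mul, add_neg_cancel, expWeight_zero]

end Triangular

/-! ### Norm of the conjugated element and conclusion -/

/-- If weighted covariance maps have norm at most `s²`, the correspondingly conjugated circular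
element has norm at most `4s`. -/
theorem IsCircular.norm_conj_le {M : Type*} [CStarAlgebra M] [WStarAlgebra M]
    {ι : Linf →⋆ₐ[ℂ] M} {E : M →L[ℂ] Linf} {α β : Linf →ₗ[ℂ] Linf} {z : M}
    (hz : IsCircular ι E α β z) (hE : IsWStarProbSpace ι E) (htr : IsFaithfulTracial E)
    {r s : ℝ} (hs : 0 ≤ s)
    (hα : ∀ b, ‖α (expWeight r * b) * expWeight (-r)‖ ≤ s ^ 2 * ‖b‖)
    (hβ : ∀ b, ‖β (expWeight (-r) * b) * expWeight r‖ ≤ s ^ 2 * ‖b‖) :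
    ‖ι (expWeight (r / 2)) * z * ι (expWeight (-(r / 2)))‖ ≤ 4 * s := by
  set u := expWeight (-(r / 2)) with hu
  set v := expWeight (r / 2) with hv
  have huv : u * v = 1 := by rw [hu, hv, expWeight_mul, neg_add_cancel, expWeight_zero]
  have hvv : v * v = expWeight r := by rw [hv, expWeight_mul, add_halves]
  have huu : u * u = expWeight (-r) := by rw [hu, expWeight_mul, ← neg_add, add_halves]
  set x := ι v * z * ι u with hx
  -- Since `u * u * v = u`, `star x * x` equals `u (p q) v` with `v = u⁻¹`. Its powers are thus
  -- conjugate to words in the circular letters `p`, `q`, whose covariances are exactly the weighted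
  -- maps in `hα` and `hβ`.
  set p := star z * ι (expWeight r) with hp
  set q := z * ι (expWeight (-r)) with hq
  have hxx : star x * x = ι u * (p * q) * ι v := by
    have h1 : ι v * ι v = ι (expWeight r) := by rw [← map_mul, hvv]
    have h2 : ι u * ι u = ι (expWeight (-r)) := by rw [← map_mul, huu]
    have h3 : ι u * ι v = 1 := by rw [← map_mul, huv, map_one]
    have hus : star (ι u) = ι u := by rw [← map_star, star_expWeight]
    have hvs : star (ι v) = ι v := by rw [← map_star, star_expWeight]
    rw [hx, star_mul, star_mul, hus, hvs, hp, hq, ← h1, ← h2]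
    simp only [mul_assoc]
    rw [h3, mul_one]
  have hpow : ∀ n : ℕ, (star x * x) ^ n = ι u * (p * q) ^ n * ι v := by
    have h3 : ι v * ι u = 1 := by rw [← map_mul, mul_comm, huv, map_one]
    have h4 : ι u * ι v = 1 := by rw [← map_mul, huv, map_one]
    intro n
    induction n with
    | zero => simp [h4]
    | succ n ih =>
      rw [pow_succ, ih, hxx, pow_succ]
      simp only [mul_assoc]
      rw [← mul_assoc (ι v) (ι u), h3, one_mul]
  set Q : Set M := {p, q} with hQ
  have hletter : ∀ a ∈ Q, IsCircularLetter ι z a := by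
    rintro a (rfl | rfl)
    · exact ⟨true, _, rfl⟩
    · exact ⟨false, _, rfl⟩
  have hcov : ∀ a ∈ Q, ∀ y ∈ Q, ∀ b, ‖E (a * ι b * y)‖ ≤ s ^ 2 * ‖b‖ := by
    have e : ∀ (a c : M) (f g b : Linf),
        E (a * ι f * ι b * (c * ι g)) = E (a * ι (f * b) * c) * g := by
      intro a c f g b
      rw [← hE.map_mul_right, map_mul ι]
      simp only [mul_assoc]
    have hnn : ∀ b : Linf, 0 ≤ s ^ 2 * ‖b‖ := fun b => by positivity
    rintro a (rfl | rfl) y (rfl | rfl) b <;> simp only [hp, hq] <;> rw [e]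
    · rw [hz.cov_star_star, zero_mul, norm_zero]
      exact hnn b
    · rw [hz.cov_star_self]
      exact hα b
    · rw [hz.cov_self_star]
      exact hβ b
    · rw [hz.cov_self_self, zero_mul, norm_zero]
      exact hnn b
  have hmom : ∀ n : ℕ, ‖(E ((star x * x) ^ n)).trace‖ ≤ (16 * s ^ 2) ^ n := by
    intro n
    -- The bimodule property and commutativity of `L^∞` cancel the conjugation under `E`.
    have e1 : E ((star x * x) ^ n) = E ((p * q) ^ n) := by
      rw [hpow, hE.map_mul_right, hE.map_mul_left, mul_comm, ← mul_assoc, mul_comm v, huv, one_mul]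
    have e2 : (p * q) ^ n = (List.replicate n [p, q]).flatten.prod := by
      simp [List.prod_flatten]
    have hlen : (List.replicate n [p, q]).flatten.length = 2 * n := by
      simp [mul_comm]
    have h1 := hz.norm_map_prod_le hE hs hletter hcov (List.replicate n [p, q]).flatten (by
      intro a ha
      simp only [List.mem_flatten, List.mem_replicate] at ha
      obtain ⟨l, ⟨-, rfl⟩, ha⟩ := ha
      simpa [hQ] using ha)
    rw [← e2, ← e1, hlen] at h1
    refine (Linf.norm_trace_le _).trans (h1.trans ?_)
    have h2 : (catalan (2 * n) : ℝ) ≤ 4 ^ (2 * n) := mod_cast catalan_le_four_pow (2 * n)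
    calc s ^ (2 * n) * (catalan (2 * n) : ℝ) ≤ s ^ (2 * n) * 4 ^ (2 * n) := by gcongr
      _ = (16 * s ^ 2) ^ n := by
        rw [← mul_pow, pow_mul]
        congr 1
        ring
  have h := htr.norm_le_of_moments_le (by positivity) hmom
  rw [CStarRing.norm_star_mul_self] at h
  exact abs_le_of_sq_le_sq' (by nlinarith) (by positivity) |>.2

theorem mainTheorem3 {M : Type*} [CStarAlgebra M] [WStarAlgebra M]
    (ι : Linf →⋆ₐ[ℂ] M) (E : M →L[ℂ] Linf)
    (hspace : IsWStarProbSpace ι E) (htrace : IsFaithfulTracial E)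
    (η : Measure (unitInterval × unitInterval)) (hη : IsCovarianceMeasure η)
    (z : M) (hz : IsCircular ι E (alphaMap η hη) (betaMap η hη) z)
    (hsupp : η {p | ¬ p.1 ≤ p.2} = 0)
    (hdiag : ∃ δ : ℝ, 0 < δ ∧
      HasBoundedDensity
        (η.restrict {p | p.1 ≤ p.2 ∧ (p.2 : ℝ) - (p.1 : ℝ) ≤ δ}) (leb.prod leb)) :
    IsQuasinilpotent z := by
  obtain ⟨δ, hδ, hdens⟩ := hdiag
  -- Needed for the spectrum to be nonempty; on the zero algebra `‖E‖ = 1` would fail.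
  have : Nontrivial M := by
    by_contra hM
    rw [not_nontrivial_iff_subsingleton] at hM
    have : E = 0 := by
      ext1 a
      rw [Subsingleton.elim a 0, map_zero, map_zero]
    simpa [this] using hspace.norm_eq_one
  have hsub : ∀ k ∈ spectrum ℂ z, k = 0 := by
    intro k hk
    refine norm_le_zero_iff.1 (le_of_forall_pos_le_add fun c hc => ?_)
    obtain ⟨s, hs, hsc⟩ : ∃ s : ℝ≥0, 0 < s ∧ 4 * (s : ℝ) = 0 + c :=
      ⟨(c / 4).toNNReal, Real.toNNReal_pos.2 (by positivity),
        by rw [Real.coe_toNNReal _ (by positivity)]; ring⟩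
    -- Covariance bound `s²` yields conjugate norm at most `4 * s = c`.
    obtain ⟨r, hr⟩ := exists_weight_norm_le hη hsupp hδ hdens (pow_pos hs 2)
    rw [← hsc]
    have huv : ∀ t : ℝ, ι (expWeight t) * ι (expWeight (-t)) = 1 := fun t => by
      rw [← map_mul, expWeight_mul, add_neg_cancel, expWeight_zero, map_one]
    let U : Mˣ := ⟨ι (expWeight (r / 2)), ι (expWeight (-(r / 2))), huv _, by
      simpa using huv (-(r / 2))⟩
    rw [← spectrum.units_conjugate (u := U)] at hk
    refine (spectrum.norm_le_norm_of_mem hk).trans ?_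
    exact hz.norm_conj_le hspace htrace s.coe_nonneg (fun b => by simpa using (hr b).1)
      (fun b => by simpa using (hr b).2)
  obtain ⟨k, hk⟩ := spectrum.nonempty z
  refine Set.Subset.antisymm hsub ?_
  rw [Set.singleton_subset_iff, ← hsub k hk]
  exact hk
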